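/- Let $X$ be a real Banach space with topological dual $X^*$, and let $F:X\times X\to\mathbb{R}$ be a monotone bifunction, i.e. $F(x,y)+F(y,x)\le 0$ for all $x,y\in X$, such that $F(x,x)=0$ for all $x\in X$. Suppose that $F(x,\cdot)$ is convex and (norm-)continuous for every $x\in X$, and that $F(\cdot,y)$ is upper hemicontinuous, i.e. upper semicontinuous on line segments, for every $y\in X$. Then $F$ is maximal monotone, that is, the operator $A^F:X\rightrightarrows X^*$ defined by $$A^F(x)=\{x^*\in X^*: F(x,y)-F(x,x)\ge\langle x^*,y-x\rangle\ \text{ for all } y\in X\},\qquad x\in X,$$ is a maximal monotone operator: $\langle y^*-x^*,y-x\rangle\ge 0$ whenever $x^*\in A^F(x)$ and $y^*\in A^F(y)$, and the graph $\{(x,x^*)\in X\times X^*:x^*\in A^F(x)\}$ is not properly included in the graph of any other monotone operator $S:X\rightrightarrows X^*$. -/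

import Mathlib

/-- A multifunction `T : X ⇉ X*`, with `X*` the topological dual of `X`. -/
abbrev DualMultifunction (X : Type*) [NormedAddCommGroup X] [NormedSpace ℝ X] :=
  X → Set (StrongDual ℝ X)

namespace DualMultifunction

/-- The graph `{(x, x*) : x* ∈ T x}` of a multifunction. -/
def graph {X : Type*} [NormedAddCommGroup X] [NormedSpace ℝ X] (T : DualMultifunction X) :
    Set (X × StrongDual ℝ X) :=
  {p | p.2 ∈ T p.1}

/-- `T` is a monotone operator: `⟨y* - x*, y - x⟩ ≥ 0` whenever `x* ∈ T x` and `y* ∈ T y`. -/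
def IsMonotone {X : Type*} [NormedAddCommGroup X] [NormedSpace ℝ X]
    (T : DualMultifunction X) : Prop :=
  ∀ x y : X, ∀ xs ∈ T x, ∀ ys ∈ T y, 0 ≤ (ys - xs) (y - x)

/-- `T` is a maximal monotone operator: it is monotone and its graph is not properly included
in the graph of any monotone operator. -/
def IsMaximalMonotone {X : Type*} [NormedAddCommGroup X] [NormedSpace ℝ X]
    (T : DualMultifunction X) : Prop :=
  T.IsMonotone ∧ ∀ S : DualMultifunction X, S.IsMonotone → ¬ (graph T ⊂ graph S)

end DualMultifunction

/-- A (real-valued) bifunction on the whole space `X`. -/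
abbrev Bifunction (X : Type*) := X → X → ℝ

namespace Bifunction

/-- `F` is a monotone bifunction: `F(x, y) + F(y, x) ≤ 0` for all `x, y`. -/
def IsMonotone {X : Type*} (F : Bifunction X) : Prop :=
  ∀ x y : X, F x y + F y x ≤ 0

/-- The operator `A^F : X ⇉ X*` attached to `F`,
`A^F(x) = {x* : F(x, y) - F(x, x) ≥ ⟨x*, y - x⟩ for all y ∈ X}`. -/
def operatorA {X : Type*} [NormedAddCommGroup X] [NormedSpace ℝ X] (F : Bifunction X) :
    DualMultifunction X :=
  fun x => {xs | ∀ y : X, xs (y - x) ≤ F x y - F x x}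

/-- `F` is a maximal monotone bifunction: `F` is monotone and `A^F` is a maximal monotone
operator. -/
def IsMaximalMonotone {X : Type*} [NormedAddCommGroup X] [NormedSpace ℝ X]
    (F : Bifunction X) : Prop :=
  F.IsMonotone ∧ F.operatorA.IsMaximalMonotone

end Bifunction

/-- `f` is upper hemicontinuous: upper semicontinuous on line segments. -/
def UpperHemicontinuousOnSegments {X : Type*} [NormedAddCommGroup X] [NormedSpace ℝ X]
    (f : X → ℝ) : Prop :=
  ∀ a b : X, UpperSemicontinuousOn f (segment ℝ a b)

/-!
Given `x*` monotonically related to the whole graph of `A^F` at `x`, test it against the operator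
at the points `z_t = (1 - t) x + t y`, where `A^F(z_t)` contains a subgradient of `F(z_t, ·)`. This
yields `(1 - t) ⟨x*, y - x⟩ ≤ F(z_t, y)`, and upper hemicontinuity of `F(·, y)` allows `t → 0`, so
`⟨x*, y - x⟩ ≤ F(x, y)`, i.e. `x* ∈ A^F(x)`.
-/

open Set Filter Topology

section Topology

variable {α β : Type*} [TopologicalSpace α] [LinearOrder β] {f g : α → β} {s : Set α} {a : α}

theorem le_of_frequently_le_of_semicontinuousWithinAt (hf : LowerSemicontinuousWithinAt f s a)
    (hg : UpperSemicontinuousWithinAt g s a) (hle : ∃ᶠ x in 𝓝[s] a, f x ≤ g x) : f a ≤ g a := by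
  by_contra! hlt
  obtain ⟨u, hu, v, hv, huv⟩ := hlt.exists_disjoint_Iio_Ioi
  have hgf : ∀ᶠ x in 𝓝[s] a, g x < f x := by
    filter_upwards [hg u hu, hf v hv] with x hgx hfx using huv _ hgx _ hfx
  obtain ⟨x, hfg, hgf⟩ := (hle.and_eventually hgf).exists
  exact hfg.not_gt hgf

end Topology

section Subgradient

variable {E : Type*} [TopologicalSpace E] {s : Set E}

theorem isOpen_strict_epigraph {β : Type*} [LinearOrder β] [TopologicalSpace β]
    [ClosedIicTopology β] {φ : E → β} (hs : IsOpen s) (hφ : UpperSemicontinuousOn φ s) :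
    IsOpen {p : E × β | p.1 ∈ s ∧ φ p.1 < p.2} := by
  refine isOpen_iff_mem_nhds.2 ?_
  rintro ⟨x, r⟩ ⟨hx, hr⟩
  obtain ⟨u, hu, v, hv, huv⟩ := hr.exists_disjoint_Iio_Ioi
  have hφu : ∀ᶠ y in 𝓝 x, φ y < u := hs.nhdsWithin_eq hx ▸ hφ x hx u hu
  filter_upwards [prod_mem_nhds (inter_mem (hs.mem_nhds hx) hφu) (Ioi_mem_nhds hv)]
    with p ⟨⟨hp, hpu⟩, hpv⟩ using ⟨hp, huv _ hpu _ hpv⟩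

variable [AddCommGroup E] [Module ℝ E] [IsTopologicalAddGroup E] [ContinuousSMul ℝ E]

theorem exists_subgradient_of_convexOn {φ : E → ℝ} (hconv : ConvexOn ℝ s φ) (hs : IsOpen s)
    (husc : UpperSemicontinuousOn φ s) {x : E} (hx : x ∈ s) :
    ∃ g : StrongDual ℝ E, ∀ y ∈ s, g (y - x) ≤ φ y - φ x := by
  obtain ⟨f, hf⟩ := geometric_hahn_banach_open_point (x := (x, φ x)) hconv.convex_strict_epigraph
    (isOpen_strict_epigraph hs husc) fun h => lt_irrefl _ h.2
  have hsplit (y : E) (r : ℝ) : f (y, r) = f (y, 0) + r * f (0, 1) := by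
    rw [← smul_eq_mul, ← map_smul, ← map_add]
    simp
  -- The separating hyperplane is not vertical, so it is the graph of an affine function.
  have hneg : f (0, 1) < 0 := by
    have h := hf (x, φ x + 1) ⟨hx, lt_add_one _⟩
    rw [hsplit x, hsplit x (φ x)] at h
    linarith
  refine ⟨(-f (0, 1))⁻¹ • f.comp (ContinuousLinearMap.inl ℝ E ℝ), fun y hy => ?_⟩
  have hsub : f (y - x, 0) = f (y, 0) - f (x, 0) := by
    rw [← map_sub, Prod.mk_sub_mk, sub_zero]
  refine le_of_forall_pos_lt_add fun ε hε => ?_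
  have h := hf (y, φ y + ε) ⟨hy, lt_add_of_pos_right _ hε⟩
  rw [hsplit y, hsplit x (φ x)] at h
  simp only [smul_apply, ContinuousLinearMap.comp_apply, ContinuousLinearMap.inl_apply,
    smul_eq_mul, hsub]
  rw [inv_mul_lt_iff₀ (neg_pos.2 hneg)]
  linarith

end Subgradient

section Maximality

variable {X : Type*} [NormedAddCommGroup X] [NormedSpace ℝ X]

namespace UpperHemicontinuousOnSegments

variable {f : X → ℝ}

theorem upperSemicontinuousOn_comp_lineMap (hf : UpperHemicontinuousOnSegments f) (a b : X) :
    UpperSemicontinuousOn (f ∘ AffineMap.lineMap a b) (Icc (0 : ℝ) 1) :=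
  (hf a b).comp AffineMap.lineMap_continuous.continuousOn fun _ ht => lineMap_mem_segment ℝ a b ht

theorem le_of_forall_le_lineMap (hf : UpperHemicontinuousOnSegments f) {a b : X} {g : ℝ → ℝ}
    (hg : LowerSemicontinuousWithinAt g (Ioo 0 1) 0)
    (hle : ∀ t ∈ Ioo (0 : ℝ) 1, g t ≤ f (AffineMap.lineMap a b t)) : g 0 ≤ f a := by
  have hfreq : ∃ᶠ t in 𝓝[Ioo (0 : ℝ) 1] 0, g t ≤ f (AffineMap.lineMap a b t) := by
    have : (𝓝[Ioo (0 : ℝ) 1] 0).NeBot := left_nhdsWithin_Ioo_neBot zero_lt_one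
    exact (eventually_mem_nhdsWithin.mono hle).frequently
  have husc : UpperSemicontinuousWithinAt (f ∘ AffineMap.lineMap a b) (Ioo (0 : ℝ) 1) 0 :=
    (hf.upperSemicontinuousOn_comp_lineMap a b 0 unitInterval.zero_mem).mono Ioo_subset_Icc_self
  simpa only [Function.comp_apply, AffineMap.lineMap_apply_zero] using
    le_of_frequently_le_of_semicontinuousWithinAt hg husc hfreq

end UpperHemicontinuousOnSegments

namespace DualMultifunction

/-- The pair `(x, x*)` is monotonically related to `T`, i.e. `⟨y* - x*, y - x⟩ ≥ 0` for every
`(y, y*)` in the graph of `T`. Maximality of a monotone operator means that every such pair already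
lies in the graph. -/
def IsMonotonicallyRelated (T : DualMultifunction X) (x : X) (xs : StrongDual ℝ X) : Prop :=
  ∀ y : X, ∀ ys ∈ T y, 0 ≤ (ys - xs) (y - x)

variable {S T : DualMultifunction X} {x : X} {xs : StrongDual ℝ X}

theorem IsMonotone.isMonotonicallyRelated_of_graph_subset (hS : S.IsMonotone)
    (hTS : T.graph ⊆ S.graph) (hx : xs ∈ S x) : T.IsMonotonicallyRelated x xs :=
  fun y ys hy => hS x y xs hx ys (hTS (show (y, ys) ∈ T.graph from hy))

theorem IsMonotone.isMaximalMonotone (hT : T.IsMonotone)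
    (hmem : ∀ x xs, T.IsMonotonicallyRelated x xs → xs ∈ T x) : T.IsMaximalMonotone :=
  ⟨hT, fun _ hS hlt => hlt.2 fun p hp =>
    hmem p.1 p.2 (hS.isMonotonicallyRelated_of_graph_subset hlt.1 hp)⟩

end DualMultifunction

namespace Bifunction

variable {F : Bifunction X} {x y : X} {xs : StrongDual ℝ X}

theorem IsMonotone.isMonotone_operatorA (hmono : F.IsMonotone) (hdiag : ∀ x, F x x = 0) :
    F.operatorA.IsMonotone := by
  intro x y xs hxs ys hys
  have hx : xs (y - x) ≤ F x y := by simpa only [hdiag, sub_zero] using hxs y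
  have hy : -ys (y - x) ≤ F y x := by
    simpa only [hdiag, sub_zero, ← map_neg, neg_sub] using hys x
  rw [sub_apply]
  linarith [hmono x y]

theorem operatorA_nonempty (hconv : ConvexOn ℝ univ (F x)) (husc : UpperSemicontinuous (F x)) :
    (F.operatorA x).Nonempty :=
  let ⟨g, hg⟩ := exists_subgradient_of_convexOn hconv isOpen_univ
    (husc.upperSemicontinuousOn univ) (mem_univ x)
  ⟨g, fun y => hg y (mem_univ y)⟩

theorem mul_le_of_isMonotonicallyRelated_operatorA (hx : F.operatorA.IsMonotonicallyRelated x xs)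
    {t : ℝ} (ht : t ∈ Ioc 0 1) {z : X} (hz : z = AffineMap.lineMap x y t)
    (hne : (F.operatorA z).Nonempty) : (1 - t) * xs (y - x) ≤ F z y - F z z := by
  obtain ⟨zs, hzs⟩ := hne
  have hzx : z - x = t • (y - x) := by
    simpa only [hz, vsub_eq_sub] using AffineMap.lineMap_vsub_left x y t
  have hyz : y - z = (1 - t) • (y - x) := by
    simpa only [hz, vsub_eq_sub] using AffineMap.right_vsub_lineMap x y t
  have hrelated : 0 ≤ t * (zs - xs) (y - x) := by
    simpa only [hzx, map_smul, smul_eq_mul] using hx z zs hzs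
  have hle : xs (y - x) ≤ zs (y - x) := sub_nonneg.1 (nonneg_of_mul_nonneg_right hrelated ht.1)
  calc
    (1 - t) * xs (y - x) ≤ (1 - t) * zs (y - x) :=
      mul_le_mul_of_nonneg_left hle (sub_nonneg.2 ht.2)
    _ = zs (y - z) := by rw [hyz, map_smul, smul_eq_mul]
    _ ≤ F z y - F z z := hzs y

theorem mem_operatorA_of_isMonotonicallyRelated (hdiag : ∀ x, F x x = 0)
    (hne : ∀ x, (F.operatorA x).Nonempty)
    (husc : ∀ y, UpperHemicontinuousOnSegments fun x => F x y)
    (hx : F.operatorA.IsMonotonicallyRelated x xs) : xs ∈ F.operatorA x := by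
  intro y
  have hcont : Continuous fun t : ℝ => (1 - t) * xs (y - x) := by fun_prop
  have hlim : (1 - 0) * xs (y - x) ≤ F x y :=
    (husc y).le_of_forall_le_lineMap (b := y)
      (hcont.lowerSemicontinuous.lowerSemicontinuousWithinAt _ _) fun t ht => by
        simpa only [hdiag, sub_zero] using
          mul_le_of_isMonotonicallyRelated_operatorA hx (Ioo_subset_Ioc_self ht) rfl (hne _)
  simpa only [hdiag, sub_zero, one_mul] using hlim

theorem IsMonotone.isMaximalMonotone_of_operatorA_nonempty (hmono : F.IsMonotone)
    (hdiag : ∀ x, F x x = 0) (hne : ∀ x, (F.operatorA x).Nonempty)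
    (husc : ∀ y, UpperHemicontinuousOnSegments fun x => F x y) : F.IsMaximalMonotone :=
  ⟨hmono, (hmono.isMonotone_operatorA hdiag).isMaximalMonotone fun _ _ =>
    mem_operatorA_of_isMonotonicallyRelated hdiag hne husc⟩

end Bifunction

theorem mainTheorem9_general (F : Bifunction X) (hmono : F.IsMonotone) (hdiag : ∀ x, F x x = 0)
    (hconv : ∀ x, ConvexOn ℝ univ (F x)) (hcont : ∀ x, Continuous (F x))
    (husc : ∀ y, UpperHemicontinuousOnSegments fun x => F x y) : F.IsMaximalMonotone :=
  hmono.isMaximalMonotone_of_operatorA_nonempty hdiag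
    (fun x => Bifunction.operatorA_nonempty (hconv x) (hcont x).upperSemicontinuous) husc

end Maximality

theorem mainTheorem9 {X : Type*} [NormedAddCommGroup X] [NormedSpace ℝ X] [CompleteSpace X]
    (F : Bifunction X)
    (hmono : F.IsMonotone)
    (hdiag : ∀ x : X, F x x = 0)
    (hconv : ∀ x : X, ConvexOn ℝ Set.univ (fun y => F x y))
    (hcont : ∀ x : X, Continuous (fun y => F x y))
    (husc : ∀ y : X, UpperHemicontinuousOnSegments (fun x => F x y)) :
    F.IsMaximalMonotone :=
  mainTheorem9_general F hmono hdiag hconv hcont husc
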